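/- Theorem. A *triangulation* of the 2-sphere here is a finite simplicial complex, given by its set of triangles, whose geometric realization is homeomorphic to the 2-sphere (equivalently, a connected closed simplicial surface, i.e. every edge lies in exactly two triangles and every vertex link is a cycle, with Euler characteristic $V-E+F=2$). An isomorphism of triangulations is a bijection of the vertex sets that maps triangles to triangles in both directions. A *three-color coloring* of a triangulation is a map from the edges of its 1-skeleton to a set of three colors such that the boundary of every triangle contains edges of all three colors. Two colorings of a triangulation are *equivalent* if one is obtained from the other by renaming the colors, up to an automorphism of the triangulation (that is, $c'(\varphi(e))=\sigma(c(e))$ for all edges $e$, for some automorphism $\varphi$ of the triangulation and some permutation $\sigma$ of the colors). The number of colorings of a triangulation is the number of equivalence classes. Consider the following nine triangulations: - $G_4$: the tetrahedron; - $G_5$: the triangular bipyramid (two tetrahedra glued along a face); - $G_{6,1}$: the octahedron; - $G_{6,2}$: $G_5$ with a vertex inserted in a face, with vertices $0,\dots,5$ and triangles $012, 015, 023, 034, 045, 123, 134, 145$ (vertex degrees $5,5,4,4,3,3$); - $G_{7,1}$: the octahedron with a vertex inserted in a face (degrees $5,5,5,4,4,4,3$); - $G_{7,2}$: the pentagonal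 bipyramid (degrees $5,5,4,4,4,4,4$); - $G_{7,3}$, $G_{7,4}$, $G_{7,5}$: $G_{6,2}$ with a vertex inserted in the face $023$, respectively $015$, respectively $034$ (degrees $6,5,5,4,4,3,3$, respectively $6,6,4,4,4,3,3$, respectively $6,5,5,5,3,3,3$). Every triangulation of the sphere with at most 7 vertices is isomorphic to exactly one of these nine. The octahedron $G_{6,1}$ and the triangulation $G_{7,1}$ have exactly two colorings each. Each of $G_4, G_5, G_{6,2}, G_{7,2}, G_{7,3}, G_{7,4}, G_{7,5}$ has exactly one. Hence exactly one triangulation with 6 vertices and one with 7 vertices (up to isomorphism) have two colorings, and every other triangulation with at most 7 vertices has exactly one. -/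

import Mathlib

/-- A (simplicial) triangulation of the 2-sphere with vertex set `V`, given by its set of triangles.
The underlying simplicial complex consists of the nonempty subsets of the triangles.
It is required to be a connected closed surface (every edge lies in exactly two triangles and the
link of every vertex is connected, hence a single cycle) of Euler characteristic 2; by the
classification of closed surfaces, these are exactly the finite simplicial complexes whose geometric
realization is homeomorphic to the 2-sphere. -/
structure SphereTriangulation (V : Type*) [Fintype V] [DecidableEq V] where
  /-- the triangles (the 2-dimensional faces) -/
  faces : Finset (Finset V)
  card_of_mem_faces : ∀ f ∈ faces, f.card = 3
  /-- every vertex is used -/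
  exists_mem_face : ∀ v : V, ∃ f ∈ faces, v ∈ f
  /-- every edge (two-element subset of a triangle) lies in exactly two triangles -/
  two_faces : ∀ e ∈ faces.biUnion (Finset.powersetCard 2), (faces.filter (e ⊆ ·)).card = 2
  /-- the 1-skeleton is connected -/
  connected : (SimpleGraph.fromRel fun u v : V => ∃ f ∈ faces, u ∈ f ∧ v ∈ f).Connected
  /-- the link of every vertex `v` is connected: here `a` and `b` are adjacent in the link of `v` if
  `{v, a, b}` is a triangle, and the vertices of the link are the neighbours of `v` -/
  link_connected : ∀ v a b : V, (∃ f ∈ faces, v ∈ f ∧ a ∈ f) → (∃ f ∈ faces, v ∈ f ∧ b ∈ f) →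
    a ≠ v → b ≠ v →
    (SimpleGraph.fromRel fun x y : V => {v, x, y} ∈ faces ∧ x ≠ v ∧ y ≠ v).Reachable a b
  /-- the Euler characteristic is 2 -/
  euler : (Fintype.card V : ℤ) - (faces.biUnion (Finset.powersetCard 2)).card + faces.card = 2

namespace SphereTriangulation

section General

variable {V W X : Type*} [Fintype V] [DecidableEq V] [Fintype W] [DecidableEq W]
  [Fintype X] [DecidableEq X]

/-- The edges of the 1-skeleton: the two-element subsets of the triangles. -/
def edges (T : SphereTriangulation V) : Finset (Finset V) :=
  T.faces.biUnion (Finset.powersetCard 2)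

/-- An isomorphism of triangulations: a bijection of the vertices that maps triangles to triangles
in both directions. -/
structure Iso (T : SphereTriangulation V) (T' : SphereTriangulation W) where
  toEquiv : V ≃ W
  map_mem_faces : ∀ s : Finset V, s.map toEquiv.toEmbedding ∈ T'.faces ↔ s ∈ T.faces

/-- Two triangulations are isomorphic. -/
def IsIsomorphic (T : SphereTriangulation V) (T' : SphereTriangulation W) : Prop :=
  Nonempty (T.Iso T')

namespace Iso

variable {T : SphereTriangulation V} {T' : SphereTriangulation W} {T'' : SphereTriangulation X}

def refl (T : SphereTriangulation V) : T.Iso T where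
  toEquiv := Equiv.refl V
  map_mem_faces s := by simp

def symm (φ : T.Iso T') : T'.Iso T where
  toEquiv := φ.toEquiv.symm
  map_mem_faces s := by
    rw [← φ.map_mem_faces, Finset.map_map]
    simp

def trans (φ : T.Iso T') (ψ : T'.Iso T'') : T.Iso T'' where
  toEquiv := φ.toEquiv.trans ψ.toEquiv
  map_mem_faces s := by
    rw [← φ.map_mem_faces, ← ψ.map_mem_faces, Finset.map_map, Equiv.trans_toEmbedding]

theorem map_mem_edges (φ : T.Iso T') {e : Finset V} (he : e ∈ T.edges) :
    e.map φ.toEquiv.toEmbedding ∈ T'.edges := by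
  simp only [edges, Finset.mem_biUnion, Finset.mem_powersetCard] at he ⊢
  obtain ⟨f, hf, hef, hc⟩ := he
  exact ⟨f.map φ.toEquiv.toEmbedding, (φ.map_mem_faces f).2 hf, Finset.map_subset_map.2 hef,
    by simpa using hc⟩

/-- The map induced on the edges by an isomorphism. -/
def mapEdge (φ : T.Iso T') (e : {e // e ∈ T.edges}) : {e // e ∈ T'.edges} :=
  ⟨e.1.map φ.toEquiv.toEmbedding, φ.map_mem_edges e.2⟩

end Iso

/-- A three-color coloring of the 1-skeleton: a coloring of the edges in three colors such that the
boundary of each triangle contains edges of all three colors. -/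
structure Coloring (T : SphereTriangulation V) where
  color : {e // e ∈ T.edges} → Fin 3
  all_colors : ∀ f ∈ T.faces, ∀ k : Fin 3, ∃ e : {e // e ∈ T.edges}, e.1 ⊆ f ∧ color e = k

/-- Two colorings are equivalent if one is obtained from the other by renaming the colors, up to an
automorphism of the triangulation. -/
def Coloring.Equivalent {T : SphereTriangulation V} (c c' : T.Coloring) : Prop :=
  ∃ (σ : Equiv.Perm (Fin 3)) (φ : T.Iso T), ∀ e, c'.color (φ.mapEdge e) = σ (c.color e)

theorem Coloring.equivalence (T : SphereTriangulation V) :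
    Equivalence (Coloring.Equivalent (T := T)) where
  refl c := ⟨Equiv.refl _, Iso.refl T, fun e => by simp [Iso.mapEdge, Iso.refl]⟩
  symm := by
    rintro c c' ⟨σ, φ, h⟩
    refine ⟨σ.symm, φ.symm, fun e => ?_⟩
    have h1 := h (φ.symm.mapEdge e)
    have h2 : φ.mapEdge (φ.symm.mapEdge e) = e := by
      apply Subtype.ext
      simp [Iso.mapEdge, Iso.symm, Finset.map_map]
    rw [h2] at h1
    rw [h1, Equiv.symm_apply_apply]
  trans := by
    rintro c c' c'' ⟨σ, φ, h⟩ ⟨τ, ψ, h'⟩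
    refine ⟨σ.trans τ, φ.trans ψ, fun e => ?_⟩
    have h2 : (φ.trans ψ).mapEdge e = ψ.mapEdge (φ.mapEdge e) := by
      apply Subtype.ext
      simp [Iso.mapEdge, Iso.trans, Finset.map_map, Equiv.trans_toEmbedding]
    rw [h2, h', h, Equiv.trans_apply]

/-- The colorings of a triangulation, with equivalence as the equivalence relation. -/
def coloringSetoid (T : SphereTriangulation V) : Setoid T.Coloring :=
  ⟨Coloring.Equivalent, Coloring.equivalence T⟩

/-- The number of pairwise inequivalent three-color colorings of a triangulation. -/
noncomputable def numColorings (T : SphereTriangulation V) : ℕ :=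
  Nat.card (Quotient T.coloringSetoid)

end General

theorem reachable_fromRel {V : Type*} (R : V → V → Prop) {a b : V} (h : a = b ∨ R a b) :
    (SimpleGraph.fromRel R).Reachable a b := by
  by_cases hab : a = b
  · exact hab ▸ SimpleGraph.Reachable.refl _
  · exact SimpleGraph.Adj.reachable
      ((SimpleGraph.fromRel_adj R a b).2 ⟨hab, Or.inl (h.resolve_left hab)⟩)

/-- A sphere triangulation on `n + 1` numbered vertices from its set of triangles `F`, with criteria
for connectedness that can be checked by evaluation: every vertex is at distance at most 2 from the
vertex 0, and every link has a vertex from which all others have distance at most 3 in the link. -/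
def ofFaces {n : ℕ} (F : Finset (Finset (Fin (n + 1))))
    (h1 : ∀ f ∈ F, f.card = 3) (h2 : ∀ v, ∃ f ∈ F, v ∈ f)
    (h3 : ∀ e ∈ F.biUnion (Finset.powersetCard 2), (F.filter (e ⊆ ·)).card = 2)
    (h4 : ∀ v, ∃ w, (∃ f ∈ F, 0 ∈ f ∧ w ∈ f) ∧ ∃ f ∈ F, w ∈ f ∧ v ∈ f)
    (h5 : ∀ v, ∃ r, ∀ a, (∃ f ∈ F, v ∈ f ∧ a ∈ f) → a ≠ v →
      ∃ w, (r = w ∨ ({v, r, w} ∈ F ∧ r ≠ v ∧ w ≠ v)) ∧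
        ∃ x, (w = x ∨ ({v, w, x} ∈ F ∧ w ≠ v ∧ x ≠ v)) ∧ (x = a ∨ ({v, x, a} ∈ F ∧ x ≠ v ∧ a ≠ v)))
    (h6 : ((n + 1 : ℕ) : ℤ) - (F.biUnion (Finset.powersetCard 2)).card + F.card = 2) :
    SphereTriangulation (Fin (n + 1)) where
  faces := F
  card_of_mem_faces := h1
  exists_mem_face := h2
  two_faces := h3
  connected := by
    have key : ∀ v, (SimpleGraph.fromRel
        fun u v : Fin (n + 1) => ∃ f ∈ F, u ∈ f ∧ v ∈ f).Reachable 0 v := by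
      intro v
      obtain ⟨w, hw, hv⟩ := h4 v
      exact (reachable_fromRel _ (Or.inr hw)).trans (reachable_fromRel _ (Or.inr hv))
    have : Nonempty (Fin (n + 1)) := ⟨0⟩
    exact ⟨fun a b => (key a).symm.trans (key b)⟩
  link_connected := by
    intro v a b ha hb hav hbv
    obtain ⟨r, hr⟩ := h5 v
    have key : ∀ a, (∃ f ∈ F, v ∈ f ∧ a ∈ f) → a ≠ v → (SimpleGraph.fromRel
        fun x y : Fin (n + 1) => {v, x, y} ∈ F ∧ x ≠ v ∧ y ≠ v).Reachable r a := by
      intro a ha hav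
      obtain ⟨w, hw, x, hx, hxa⟩ := hr a ha hav
      exact ((reachable_fromRel _ hw).trans (reachable_fromRel _ hx)).trans
        (reachable_fromRel _ hxa)
    exact (key a ha hav).symm.trans (key b hb hbv)
  euler := by simpa using h6

/-- The tetrahedron. -/
def G4 : SphereTriangulation (Fin 4) :=
  ofFaces
    {{0, 1, 2}, {0, 1, 3}, {0, 2, 3}, {1, 2, 3}}
    (by decide +kernel) (by decide +kernel) (by decide +kernel) (by decide +kernel)
    (by decide +kernel) (by decide +kernel)

/-- The triangular bipyramid. -/
def G5 : SphereTriangulation (Fin 5) :=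
  ofFaces
    {{0, 1, 2}, {0, 1, 4}, {0, 2, 3}, {0, 3, 4}, {1, 2, 3}, {1, 3, 4}}
    (by decide +kernel) (by decide +kernel) (by decide +kernel) (by decide +kernel)
    (by decide +kernel) (by decide +kernel)

/-- The octahedron. -/
def G61 : SphereTriangulation (Fin 6) :=
  ofFaces
    {{0, 1, 2}, {0, 1, 3}, {0, 2, 4}, {0, 3, 4}, {1, 2, 5}, {1, 3, 5}, {2, 4, 5},
      {3, 4, 5}}
    (by decide +kernel) (by decide +kernel) (by decide +kernel) (by decide +kernel)
    (by decide +kernel) (by decide +kernel)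

/-- The triangular bipyramid with one more vertex inserted in a face: vertex degrees
5, 5, 4, 4, 3, 3. -/
def G62 : SphereTriangulation (Fin 6) :=
  ofFaces
    {{0, 1, 2}, {0, 1, 5}, {0, 2, 3}, {0, 3, 4}, {0, 4, 5}, {1, 2, 3}, {1, 3, 4},
      {1, 4, 5}}
    (by decide +kernel) (by decide +kernel) (by decide +kernel) (by decide +kernel)
    (by decide +kernel) (by decide +kernel)

/-- The octahedron with a vertex inserted in a face: vertex degrees 5, 5, 5, 4, 4, 4, 3. -/
def G71 : SphereTriangulation (Fin 7) :=
  ofFaces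
    {{0, 1, 3}, {0, 2, 4}, {0, 3, 4}, {1, 2, 5}, {1, 3, 5}, {2, 4, 5}, {3, 4, 5},
      {0, 1, 6}, {0, 2, 6}, {1, 2, 6}}
    (by decide +kernel) (by decide +kernel) (by decide +kernel) (by decide +kernel)
    (by decide +kernel) (by decide +kernel)

/-- The pentagonal bipyramid: vertex degrees 5, 5, 4, 4, 4, 4, 4. -/
def G72 : SphereTriangulation (Fin 7) :=
  ofFaces
    {{0, 1, 2}, {0, 2, 3}, {0, 3, 4}, {0, 4, 5}, {0, 1, 5}, {1, 2, 6}, {2, 3, 6},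
      {3, 4, 6}, {4, 5, 6}, {1, 5, 6}}
    (by decide +kernel) (by decide +kernel) (by decide +kernel) (by decide +kernel)
    (by decide +kernel) (by decide +kernel)

/-- `G62` with a vertex inserted in the face `{0, 2, 3}`: vertex degrees 6, 5, 5, 4, 4, 3, 3. -/
def G73 : SphereTriangulation (Fin 7) :=
  ofFaces
    {{0, 1, 2}, {0, 1, 5}, {0, 3, 4}, {0, 4, 5}, {1, 2, 3}, {1, 3, 4}, {1, 4, 5},
      {0, 2, 6}, {0, 3, 6}, {2, 3, 6}}
    (by decide +kernel) (by decide +kernel) (by decide +kernel) (by decide +kernel)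
    (by decide +kernel) (by decide +kernel)

/-- `G62` with a vertex inserted in the face `{0, 1, 5}`: vertex degrees 6, 6, 4, 4, 4, 3, 3. -/
def G74 : SphereTriangulation (Fin 7) :=
  ofFaces
    {{0, 1, 2}, {0, 2, 3}, {0, 3, 4}, {0, 4, 5}, {1, 2, 3}, {1, 3, 4}, {1, 4, 5},
      {0, 1, 6}, {0, 5, 6}, {1, 5, 6}}
    (by decide +kernel) (by decide +kernel) (by decide +kernel) (by decide +kernel)
    (by decide +kernel) (by decide +kernel)

/-- `G62` with a vertex inserted in the face `{0, 3, 4}`: vertex degrees 6, 5, 5, 5, 3, 3, 3. -/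
def G75 : SphereTriangulation (Fin 7) :=
  ofFaces
    {{0, 1, 2}, {0, 1, 5}, {0, 2, 3}, {0, 4, 5}, {1, 2, 3}, {1, 3, 4}, {1, 4, 5},
      {0, 3, 6}, {0, 4, 6}, {3, 4, 6}}
    (by decide +kernel) (by decide +kernel) (by decide +kernel) (by decide +kernel)
    (by decide +kernel) (by decide +kernel)

/-- Names for the nine triangulations above. -/
inductive SmallName
  | g4 | g5 | g61 | g62 | g71 | g72 | g73 | g74 | g75

/-- The number of vertices of a named triangulation. -/
def SmallName.order : SmallName → ℕ
  | g4 => 4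
  | g5 => 5
  | g61 | g62 => 6
  | g71 | g72 | g73 | g74 | g75 => 7

/-- The triangulation with a given name. -/
def small : (i : SmallName) → SphereTriangulation (Fin i.order)
  | .g4 => G4
  | .g5 => G5
  | .g61 => G61
  | .g62 => G62
  | .g71 => G71
  | .g72 => G72
  | .g73 => G73
  | .g74 => G74
  | .g75 => G75

end SphereTriangulation

/-! Counting incidences of edges and triangles turns Euler characteristic 2 into F = 2V − 4
(`card_faces`). Connectedness of the 1-skeleton and of the links makes any nonempty set of triangles
with two triangles at each of its edges the whole sphere (`faces_eq_of_closed`). Hence a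
triangulation can be grown from one triangle: an edge lying in only one of the triangles found so
far has a second one, whose third vertex is already numbered or receives the next number. The finite
tree of these choices is evaluated for 4 ≤ n ≤ 7. One of its branches follows the given
triangulation (`exists_leaf_of_searchTriangulations`), and its final list embeds in one of the nine
lists; such an embedding is an isomorphism (`Realizes.exists_iso`). The nine are told apart by the
number of vertices and the numbers of vertices of degree 4 and 5.

Colorings of the nine are enumerated edge by edge in the same spirit, and each is matched with a
representative by an automorphism and a renaming of the colors (`SmallName.exists_equivalent`). The
representatives are encoded by proper vertex colorings in the Klein four-group: an edge receives the
difference of its ends, so the three distinct vertex colors of a triangle yield all three nonzero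
differences. Where there are two representatives, they differ in the number of vertices at which
some color is missing: 6 against 2 for the octahedron, 3 against 1 for `G71`. `Iso.numColorings_eq`
carries the counts over to arbitrary triangulations. -/

namespace SphereTriangulation

/-! ### Face count and closed subsets of a sphere. -/

section Surface

variable {V W : Type*} [Fintype V] [DecidableEq V] [Fintype W] [DecidableEq W]

theorem mem_edges_iff (T : SphereTriangulation V) {e : Finset V} :
    e ∈ T.edges ↔ ∃ f ∈ T.faces, e ⊆ f ∧ e.card = 2 := by
  simp [edges, Finset.mem_powersetCard]

theorem card_filter_subset (T : SphereTriangulation V) {e f : Finset V} (hf : f ∈ T.faces)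
    (he : e ⊆ f) (hc : e.card = 2) : (T.faces.filter (e ⊆ ·)).card = 2 :=
  T.two_faces e (T.mem_edges_iff.2 ⟨f, hf, he, hc⟩)

theorem card_faces (T : SphereTriangulation V) : T.faces.card + 4 = 2 * Fintype.card V := by
  have h := Finset.sum_card_bipartiteAbove_eq_sum_card_bipartiteBelow (s := T.edges)
    (t := T.faces) (fun e f : Finset V => e ⊆ f)
  have h1 : ∑ e ∈ T.edges, (T.faces.bipartiteAbove (fun e f : Finset V => e ⊆ f) e).card
      = ∑ e ∈ T.edges, 2 := Finset.sum_congr rfl fun e he => T.two_faces e he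
  have h2 : ∑ f ∈ T.faces, (T.edges.bipartiteBelow (fun e f : Finset V => e ⊆ f) f).card
      = ∑ f ∈ T.faces, 3 := by
    refine Finset.sum_congr rfl fun f hf => ?_
    have : T.edges.bipartiteBelow (fun e f : Finset V => e ⊆ f) f = Finset.powersetCard 2 f := by
      ext e
      simp only [Finset.bipartiteBelow, Finset.mem_filter, Finset.mem_powersetCard, mem_edges_iff]
      exact ⟨fun ⟨⟨_, _, _, h⟩, h'⟩ => ⟨h', h⟩, fun ⟨h, h'⟩ => ⟨⟨f, hf, h, h'⟩, h⟩⟩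
    rw [this, Finset.card_powersetCard, T.card_of_mem_faces f hf]
    rfl
  rw [h1, h2, Finset.sum_const, Finset.sum_const, smul_eq_mul, smul_eq_mul] at h
  have he := T.euler
  change (Fintype.card V : ℤ) - T.edges.card + _ = 2 at he
  omega

/-- A nonempty set of triangles in which every edge lies in two triangles is the whole sphere. -/
theorem faces_eq_of_closed (T : SphereTriangulation V) {S : Finset (Finset V)}
    (hS : S ⊆ T.faces) (hne : S.Nonempty)
    (h : ∀ f ∈ S, ∀ e ⊆ f, e.card = 2 → (S.filter (e ⊆ ·)).card = 2) : S = T.faces := by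
  -- `S` crosses edges: at an edge of a member, `S` and `T` both have two triangles, so they have
  -- the same ones.
  have spread : ∀ f ∈ S, ∀ g ∈ T.faces, ∀ u v, u ≠ v → u ∈ f → v ∈ f → u ∈ g → v ∈ g →
      g ∈ S := by
    intro f hf g hg u v huv hu hv hu' hv'
    have hef : ({u, v} : Finset V) ⊆ f := by simp [Finset.insert_subset_iff, hu, hv]
    have heg : ({u, v} : Finset V) ⊆ g := by simp [Finset.insert_subset_iff, hu', hv']
    have hc : ({u, v} : Finset V).card = 2 := Finset.card_pair huv
    have heq : S.filter (({u, v} : Finset V) ⊆ ·) = T.faces.filter (({u, v} : Finset V) ⊆ ·) :=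
      Finset.eq_of_subset_of_card_le (Finset.filter_subset_filter _ hS)
        (by rw [h f hf _ hef hc, T.card_filter_subset (hS hf) hef hc])
    have : g ∈ T.faces.filter (({u, v} : Finset V) ⊆ ·) := Finset.mem_filter.2 ⟨hg, heg⟩
    exact (Finset.mem_filter.1 (heq ▸ this)).1
  have other : ∀ f ∈ T.faces, ∀ v, ∃ a ∈ f, a ≠ v := by
    intro f hf v
    by_contra! hcon
    have : f ⊆ {v} := fun a ha => by simpa using hcon a ha
    have := Finset.card_le_card this
    rw [T.card_of_mem_faces f hf] at this
    simp at this
  -- `S` turns around vertices: a walk in the link of `v` is a chain of triangles at `v`,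
  -- consecutive ones sharing an edge through `v`.
  have star : ∀ f ∈ S, ∀ v ∈ f, ∀ g ∈ T.faces, v ∈ g → g ∈ S := by
    intro f hf v hv g hg hvg
    obtain ⟨a, ha, hav⟩ := other f (hS hf) v
    obtain ⟨b, hb, hbv⟩ := other g hg v
    obtain ⟨p⟩ := T.link_connected v a b ⟨f, hS hf, hv, ha⟩ ⟨g, hg, hvg, hb⟩ hav hbv
    have key : ∀ {x y : V} (p : (SimpleGraph.fromRel fun x y : V =>
        {v, x, y} ∈ T.faces ∧ x ≠ v ∧ y ≠ v).Walk x y), x ≠ v → (∃ f ∈ S, v ∈ f ∧ x ∈ f) →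
        ∃ f ∈ S, v ∈ f ∧ y ∈ f := by
      intro x y p
      induction p with
      | nil => exact fun _ h => h
      | @cons x z y hadj p ih =>
        rintro hx ⟨f, hf, hvf, hxf⟩
        rw [SimpleGraph.fromRel_adj] at hadj
        have hz : z ≠ v := by rcases hadj.2 with h | h <;> tauto
        have hface : ({v, x, z} : Finset V) ∈ T.faces := by
          rcases hadj.2 with h | h
          · exact h.1
          · rw [Finset.pair_comm x z]; exact h.1
        exact ih hz ⟨{v, x, z}, spread f hf _ hface v x hx.symm hvf hxf (by simp) (by simp),
          by simp, by simp⟩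
    obtain ⟨f', hf', hvf', hbf'⟩ := key p hav ⟨f, hf, hv, ha⟩
    exact spread f' hf' g hg v b hbv.symm hvf' hbf' hvg hb
  have reach : ∀ {u v : V} (p : (SimpleGraph.fromRel
      fun u v : V => ∃ f ∈ T.faces, u ∈ f ∧ v ∈ f).Walk u v), (∃ f ∈ S, u ∈ f) →
      ∃ f ∈ S, v ∈ f := by
    intro u v p
    induction p with
    | nil => exact id
    | cons hadj p ih =>
      rintro ⟨f, hf, huf⟩
      rw [SimpleGraph.fromRel_adj] at hadj
      refine ih ?_
      rcases hadj.2 with ⟨g, hg, h1, h2⟩ | ⟨g, hg, h2, h1⟩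
      · exact ⟨g, star f hf _ huf g hg h1, h2⟩
      · exact ⟨g, star f hf _ huf g hg h1, h2⟩
  refine Finset.Subset.antisymm hS fun g hg => ?_
  obtain ⟨f, hf⟩ := hne
  obtain ⟨u, hu, -⟩ := other f (hS hf) (T.connected.nonempty.some)
  obtain ⟨v, hv, -⟩ := other g hg u
  obtain ⟨p⟩ := T.connected.preconnected u v
  obtain ⟨f', hf', hv'⟩ := reach p ⟨f, hf, hu⟩
  exact star f' hf' v hv' g hg hv

end Surface

/-! ### Partial triangulations as lists of numbered triangles, and their exhaustive growth. -/

section Labelled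

/-- A triangle on numbered vertices. -/
abbrev Tri := ℕ × ℕ × ℕ

def Tri.hasVertex (a : ℕ) (t : Tri) : Bool :=
  Nat.beq a t.1 || (Nat.beq a t.2.1 || Nat.beq a t.2.2)

def Tri.hasEdge (a b : ℕ) (t : Tri) : Bool := t.hasVertex a && t.hasVertex b

/-- The number of triangles of `S` that contain `a` and `b`. -/
def edgeCount (S : List Tri) (a b : ℕ) : ℕ := S.countP (Tri.hasEdge a b)

/-- Every edge of a triangle of `S` lies in two triangles of `S`. -/
def closedList (S : List Tri) : Bool :=
  S.all fun t => Nat.beq (edgeCount S t.1 t.2.1) 2 && (Nat.beq (edgeCount S t.1 t.2.2) 2 &&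
    Nat.beq (edgeCount S t.2.1 t.2.2) 2)

/-- The triangle with vertices named by `f`. -/
def Tri.image {V : Type*} [DecidableEq V] (f : ℕ → V) (t : Tri) : Finset V :=
  {f t.1, f t.2.1, f t.2.2}

abbrev Tri.Below (k : ℕ) (t : Tri) : Prop := t.1 < k ∧ t.2.1 < k ∧ t.2.2 < k

theorem Tri.hasVertex_iff {a : ℕ} {t : Tri} :
    t.hasVertex a = true ↔ a = t.1 ∨ a = t.2.1 ∨ a = t.2.2 := by
  simp [Tri.hasVertex]

theorem Tri.hasVertex_iff_mem {V : Type*} [DecidableEq V] {f : ℕ → V} {k a : ℕ} {t : Tri}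
    (hf : Set.InjOn f (Set.Iio k)) (ht : t.Below k) (ha : a < k) :
    t.hasVertex a = true ↔ f a ∈ t.image f := by
  obtain ⟨h1, h2, h3⟩ := ht
  simp only [Tri.hasVertex_iff, Tri.image, Finset.mem_insert, Finset.mem_singleton,
    hf.eq_iff (Set.mem_Iio.2 ha) (Set.mem_Iio.2 h1), hf.eq_iff (Set.mem_Iio.2 ha)
    (Set.mem_Iio.2 h2), hf.eq_iff (Set.mem_Iio.2 ha) (Set.mem_Iio.2 h3)]

theorem Tri.hasEdge_iff_subset {V : Type*} [DecidableEq V] {f : ℕ → V} {k a b : ℕ} {t : Tri}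
    (hf : Set.InjOn f (Set.Iio k)) (ht : t.Below k) (ha : a < k) (hb : b < k) :
    t.hasEdge a b = true ↔ {f a, f b} ⊆ t.image f := by
  rw [Tri.hasEdge, Bool.and_eq_true, hasVertex_iff_mem hf ht ha, hasVertex_iff_mem hf ht hb,
    Finset.insert_subset_iff, Finset.singleton_subset_iff]

theorem Tri.below_of_hasVertex {a k : ℕ} {t : Tri} (ht : t.Below k) (h : t.hasVertex a = true) :
    a < k := by
  obtain ⟨h1, h2, h3⟩ := ht
  rcases Tri.hasVertex_iff.1 h with rfl | rfl | rfl <;> assumption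

theorem Tri.image_congr {V : Type*} [DecidableEq V] {f g : ℕ → V} {k : ℕ} {t : Tri}
    (ht : t.Below k) (h : ∀ a < k, g a = f a) : t.image g = t.image f := by
  rw [Tri.image, Tri.image, h _ ht.1, h _ ht.2.1, h _ ht.2.2]

variable {V W : Type*} [Fintype V] [DecidableEq V] [Fintype W] [DecidableEq W]

/-- The list `S` consists of distinct triangles of `T`, if the vertices of `T` are numbered by `f`,
with numbers less than `k`. -/
structure Realizes (T : SphereTriangulation V) (f : ℕ → V) (k : ℕ) (S : List Tri) : Prop where
  -- The values of `f` from `k` on are irrelevant; a total `f` can be updated at `k` when a new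
  -- vertex is found.
  injOn : Set.InjOn f (Set.Iio k)
  below : ∀ t ∈ S, t.Below k
  mem_faces : ∀ t ∈ S, t.image f ∈ T.faces
  nodup : (S.map (Tri.image f)).Nodup

namespace Realizes

variable {T : SphereTriangulation V} {T' : SphereTriangulation W} {f : ℕ → V} {g : ℕ → W}
  {k n : ℕ} {S : List Tri}

theorem subset (h : Realizes T f k S) : (S.map (Tri.image f)).toFinset ⊆ T.faces := by
  intro s hs
  obtain ⟨t, ht, rfl⟩ := List.mem_map.1 (List.mem_toFinset.1 hs)
  exact h.mem_faces t ht

theorem card_toFinset (h : Realizes T f k S) :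
    (S.map (Tri.image f)).toFinset.card = S.length := by
  rw [List.toFinset_card_of_nodup h.nodup, List.length_map]

theorem length_le (h : Realizes T f k S) : S.length ≤ T.faces.card := by
  rw [← h.card_toFinset]
  exact Finset.card_le_card h.subset

theorem le_card (h : Realizes T f k S) : k ≤ Fintype.card V := by
  have := Finset.card_le_univ ((Finset.range k).image f)
  rwa [Finset.card_image_of_injOn (by simpa using h.injOn), Finset.card_range] at this

/-- This is where `nodup` matters: a repeated triangle would be counted twice in the list but once
in the set. -/
theorem card_filter (h : Realizes T f k S) {a b : ℕ} (ha : a < k) (hb : b < k) :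
    ((S.map (Tri.image f)).toFinset.filter ({f a, f b} ⊆ ·)).card = edgeCount S a b := by
  have hfilter : (S.map (Tri.image f)).toFinset.filter ({f a, f b} ⊆ ·) =
      ((S.map (Tri.image f)).filter fun s => decide ({f a, f b} ⊆ s)).toFinset := by
    ext; simp
  rw [hfilter, List.toFinset_card_of_nodup (h.nodup.filter _), List.filter_map,
    List.length_map, edgeCount, List.countP_eq_length_filter]
  congr 1
  refine List.filter_congr fun t ht => ?_
  rw [Bool.eq_iff_iff, Tri.hasEdge_iff_subset h.injOn (h.below t ht) ha hb]
  simp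

theorem faces_eq (h : Realizes T f k S) (hS : S ≠ []) (hc : closedList S = true) :
    (S.map (Tri.image f)).toFinset = T.faces := by
  refine T.faces_eq_of_closed h.subset (by simpa using hS) fun s hs e he he2 => ?_
  obtain ⟨t, ht, rfl⟩ := List.mem_map.1 (List.mem_toFinset.1 hs)
  obtain ⟨h1, h2, h3⟩ := h.below t ht
  have hct := List.all_eq_true.1 hc t ht
  simp only [Bool.and_eq_true, Nat.beq_eq] at hct
  obtain ⟨x, y, hxy, rfl⟩ := Finset.card_eq_two.1 he2
  have hx : x ∈ t.image f := he (by simp)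
  have hy : y ∈ t.image f := he (by simp)
  simp only [Tri.image, Finset.mem_insert, Finset.mem_singleton] at hx hy
  rcases hx with rfl | rfl | rfl <;> rcases hy with rfl | rfl | rfl <;>
    first
    | exact absurd rfl hxy
    | exact (h.card_filter (by assumption) (by assumption)).trans (by tauto)
    | (rw [Finset.pair_comm]
       exact (h.card_filter (by assumption) (by assumption)).trans (by tauto))

theorem surj (h : Realizes T f k S) (hS : S ≠ []) (hc : closedList S = true) (v : V) :
    ∃ a < k, f a = v := by
  obtain ⟨s, hs, hv⟩ := T.exists_mem_face v
  rw [← h.faces_eq hS hc] at hs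
  obtain ⟨t, ht, rfl⟩ := List.mem_map.1 (List.mem_toFinset.1 hs)
  obtain ⟨h1, h2, h3⟩ := h.below t ht
  simp only [Tri.image, Finset.mem_insert, Finset.mem_singleton] at hv
  rcases hv with rfl | rfl | rfl
  exacts [⟨_, h1, rfl⟩, ⟨_, h2, rfl⟩, ⟨_, h3, rfl⟩]

theorem exists_equiv (h : Realizes T f k S) (hS : S ≠ []) (hc : closedList S = true) :
    ∃ e : Fin k ≃ V, ∀ a, e a = f a := by
  refine ⟨Equiv.ofBijective (fun a : Fin k => f a) ⟨fun a b hab => ?_, fun v => ?_⟩, fun a => rfl⟩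
  · exact Fin.ext (h.injOn a.2 b.2 hab)
  · obtain ⟨a, ha, rfl⟩ := h.surj hS hc v
    exact ⟨⟨a, ha⟩, rfl⟩

/-- A closed list is the complete set of triangles on both sides, so matching the two numberings
preserves faces. The formula for the vertices is needed to transport colors. -/
theorem exists_iso (h : Realizes T f k S) (h' : Realizes T' g k S) (hS : S ≠ [])
    (hc : closedList S = true) : ∃ φ : T.Iso T', ∀ a < k, φ.toEquiv (f a) = g a := by
  obtain ⟨e, he⟩ := h.exists_equiv hS hc
  obtain ⟨e', he'⟩ := h'.exists_equiv hS hc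
  have key : ∀ a < k, (e.symm.trans e') (f a) = g a := by
    intro a ha
    rw [← he ⟨a, ha⟩, ← he' ⟨a, ha⟩]
    simp
  have himg : ∀ t ∈ S, (t.image f).map (e.symm.trans e').toEmbedding = t.image g := by
    intro t ht
    obtain ⟨h1, h2, h3⟩ := h.below t ht
    simp only [Tri.image, Finset.map_insert, Finset.map_singleton, Equiv.coe_toEmbedding,
      key _ h1, key _ h2, key _ h3]
  refine ⟨⟨e.symm.trans e', fun s => ?_⟩, key⟩
  rw [← h.faces_eq hS hc, ← h'.faces_eq hS hc, List.mem_toFinset, List.mem_toFinset, List.mem_map,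
    List.mem_map]
  constructor
  · rintro ⟨t, ht, hts⟩
    exact ⟨t, ht, Finset.map_injective _ ((himg t ht).trans hts)⟩
  · rintro ⟨t, ht, rfl⟩
    exact ⟨t, ht, (himg t ht).symm⟩

end Realizes

/-- Search for a triangulation of the sphere with `n` vertices that does not pass the test `leaf`:
`S` is the list of triangles found so far, with vertices `0, …, k - 1`, and `Q` lists the edges that
may have to be completed. -/
def searchTriangulations (n : ℕ) (leaf : List Tri → Bool) :
    ℕ → ℕ → List Tri → List (ℕ × ℕ) → Bool
  -- Running out of fuel is a failure, so a successful evaluation also certifies that the fuel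
  -- sufficed.
  | 0, _, _, _ => false
  | _ + 1, k, S, [] =>
    -- Since closedness is tested here, nothing has to be proved about which edges the queue
    -- contains. Closed lists with the wrong counts cannot come from a sphere with `n` vertices.
    closedList S && (!(Nat.beq k n && Nat.beq (S.length + 4) (2 * n)) || leaf S)
  | fuel + 1, k, S, (a, b) :: Q =>
    bif Nat.beq (edgeCount S a b) 1 && !Nat.beq a b then
      -- Branches are cut when all 2n − 4 triangles are used up, when `c` would be one vertex too
      -- many, or when an edge at `c` already has two triangles. The value `c = k` stands for a new
      -- vertex.
      Nat.ble (2 * n) (S.length + 4) || (List.range (k + 1)).all fun c =>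
        Nat.beq c n || (Nat.beq c a || (Nat.beq c b || (Nat.ble 2 (edgeCount S a c) ||
          (Nat.ble 2 (edgeCount S b c) ||
            searchTriangulations n leaf fuel (bif Nat.beq c k then k + 1 else k) ((a, b, c) :: S)
              (Q ++ [(a, c), (b, c)])))))
    else searchTriangulations n leaf fuel k S Q

end Labelled

/-! ### Search for embeddings into the nine named lists. -/

section Labelled

/-- The number of triangles of `S` at each of the vertices `0, …, n - 1`. -/
def degreeList (n : ℕ) (S : List Tri) : List ℕ :=
  (List.range n).map fun a => S.countP (Tri.hasVertex a)

/-- Only the inclusion of the vertices of `t` in those of `s` is tested; equality follows once both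
are known to have three vertices. -/
def Tri.same (s t : Tri) : Bool :=
  s.hasVertex t.1 && (s.hasVertex t.2.1 && s.hasVertex t.2.2)

def Tri.relabel (p : List ℕ) (t : Tri) : Tri :=
  (p.getD t.1 0, p.getD t.2.1 0, p.getD t.2.2 0)

def Tri.ble (t : Tri) (k : ℕ) : Bool := Nat.ble t.1 k && (Nat.ble t.2.1 k && Nat.ble t.2.2 k)

/-- The list `p` of numbers less than `n` sends the triangles of `S` to triangles of `G`. -/
def isEmbedding (n : ℕ) (G S : List Tri) (p : List ℕ) : Bool :=
  decide p.Nodup && (Nat.beq p.length n && (p.all (Nat.blt · n) &&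
    S.all fun t => G.any fun s => s.same (t.relabel p)))

/-- Search for an embedding `p` of `S` in `G` with the property `test`, where `p` is found one
entry after the other and has to respect the lists `dG` and `dS` of vertex degrees. -/
def searchEmbedding (n : ℕ) (G S : List Tri) (dG dS : List ℕ) (test : List ℕ → Bool) :
    ℕ → ℕ → List ℕ → Bool
  | 0, _, p => isEmbedding n G S p && test p
  | r + 1, k, p => (List.range n).any fun v =>
    Nat.beq (dG.getD v 0) (dS.getD k 0) && (!p.any (Nat.beq v) &&
      -- The triangles with largest vertex `k` are those whose last vertex has just been placed.
      -- This and the degree test only prune: `isEmbedding` checks the finished list again.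
      (S.all (fun t => !(t.hasVertex k && t.ble k) ||
        G.any fun s => s.same (t.relabel (p ++ [v]))) &&
      searchEmbedding n G S dG dS test r (k + 1) (p ++ [v])))

/-- The triangles of the named triangulations. -/
def SmallName.tris : SmallName → List Tri
  | g4 => [(0, 1, 2), (0, 1, 3), (0, 2, 3), (1, 2, 3)]
  | g5 => [(0, 1, 2), (0, 1, 4), (0, 2, 3), (0, 3, 4), (1, 2, 3), (1, 3, 4)]
  | g61 => [(0, 1, 2), (0, 1, 3), (0, 2, 4), (0, 3, 4), (1, 2, 5), (1, 3, 5), (2, 4, 5), (3, 4, 5)]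
  | g62 => [(0, 1, 2), (0, 1, 5), (0, 2, 3), (0, 3, 4), (0, 4, 5), (1, 2, 3), (1, 3, 4), (1, 4, 5)]
  | g71 => [(0, 1, 3), (0, 2, 4), (0, 3, 4), (1, 2, 5), (1, 3, 5), (2, 4, 5), (3, 4, 5),
      (0, 1, 6), (0, 2, 6), (1, 2, 6)]
  | g72 => [(0, 1, 2), (0, 2, 3), (0, 3, 4), (0, 4, 5), (0, 1, 5), (1, 2, 6), (2, 3, 6),
      (3, 4, 6), (4, 5, 6), (1, 5, 6)]
  | g73 => [(0, 1, 2), (0, 1, 5), (0, 3, 4), (0, 4, 5), (1, 2, 3), (1, 3, 4), (1, 4, 5),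
      (0, 2, 6), (0, 3, 6), (2, 3, 6)]
  | g74 => [(0, 1, 2), (0, 2, 3), (0, 3, 4), (0, 4, 5), (1, 2, 3), (1, 3, 4), (1, 4, 5),
      (0, 1, 6), (0, 5, 6), (1, 5, 6)]
  | g75 => [(0, 1, 2), (0, 1, 5), (0, 2, 3), (0, 4, 5), (1, 2, 3), (1, 3, 4), (1, 4, 5),
      (0, 3, 6), (0, 4, 6), (3, 4, 6)]

/-- The triangles in `S`, with vertices `0, …, n - 1`, are those of one of the named
triangulations. -/
def isSmall (n : ℕ) (S : List Tri) : Bool :=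
  [SmallName.g4, .g5, .g61, .g62, .g71, .g72, .g73, .g74, .g75].any fun i =>
    Nat.beq i.order n && searchEmbedding n i.tris S (degreeList n i.tris) (degreeList n S)
      (fun _ => true) n 0 []

end Labelled

/-! ### Comparing triangles through their sets of numbers. -/

section Labelled

theorem Tri.image_eq_of_same {V : Type*} [DecidableEq V] {f : ℕ → V} {s t : Tri} (h : s.same t = true)
    (ht : (t.image f).card = (s.image f).card) : t.image f = s.image f := by
  refine Finset.eq_of_subset_of_card_le ?_ ht.ge
  have hv : ∀ a, s.hasVertex a = true → f a ∈ s.image f := by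
    intro a ha
    rcases Tri.hasVertex_iff.1 ha with rfl | rfl | rfl <;> simp [Tri.image]
  rw [Tri.same, Bool.and_eq_true, Bool.and_eq_true] at h
  simp only [Tri.image, Finset.insert_subset_iff, Finset.singleton_subset_iff]
  exact ⟨hv _ h.1, hv _ h.2.1, hv _ h.2.2⟩

theorem Tri.image_id_image {V : Type*} [DecidableEq V] (f : ℕ → V) (t : Tri) :
    (t.image id).image f = t.image f := by
  simp [Tri.image, Finset.image_insert]

theorem Tri.Below.image_id_subset {n : ℕ} {t : Tri} (ht : t.Below n) :
    (t.image id : Set ℕ) ⊆ Set.Iio n := by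
  obtain ⟨h1, h2, h3⟩ := ht
  simp [Tri.image, Set.insert_subset_iff, h1, h2, h3]

theorem Tri.card_image {V : Type*} [DecidableEq V] {f : ℕ → V} {n : ℕ}
    (hf : Set.InjOn f (Set.Iio n)) {t : Tri} (ht : t.Below n) :
    (t.image f).card = (t.image id).card := by
  rw [← Tri.image_id_image f, Finset.card_image_of_injOn (hf.mono ht.image_id_subset)]

theorem Tri.image_eq_image_iff {V : Type*} [DecidableEq V] {f : ℕ → V} {n : ℕ}
    (hf : Set.InjOn f (Set.Iio n)) {s t : Tri} (hs : s.Below n) (ht : t.Below n) :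
    s.image f = t.image f ↔ s.image id = t.image id := by
  rw [← Tri.image_id_image f, ← Tri.image_id_image f, ← Finset.coe_inj, Finset.coe_image,
    Finset.coe_image, hf.image_eq_image_iff hs.image_id_subset ht.image_id_subset, Finset.coe_inj]

end Labelled

/-! ### Soundness of the searches. -/

section Search

variable {V W : Type*} [Fintype V] [DecidableEq V] [Fintype W] [DecidableEq W]

/-- Three vertices span only one triangle, but the face count would require two. -/
theorem four_le_card (T : SphereTriangulation V) : 4 ≤ Fintype.card V := by
  have h := T.card_faces
  obtain ⟨f, hf, -⟩ := T.exists_mem_face T.connected.nonempty.some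
  have h3 : 3 ≤ Fintype.card V := T.card_of_mem_faces f hf ▸ Finset.card_le_univ f
  by_contra! hlt
  have hsub : T.faces ⊆ {Finset.univ} := fun g hg => Finset.mem_singleton.2
    ((Finset.card_eq_iff_eq_univ g).1 (by rw [T.card_of_mem_faces g hg]; omega))
  have := Finset.card_le_card hsub
  rw [Finset.card_singleton] at this
  omega

namespace Realizes

variable {T : SphereTriangulation V} {f : ℕ → V} {k n : ℕ} {S : List Tri}

theorem edgeCount_le (h : Realizes T f k S) {a b : ℕ} (ha : a < k) (hb : b < k) (hab : a ≠ b) :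
    edgeCount S a b ≤ 2 := by
  rw [← h.card_filter ha hb]
  by_contra! hlt
  obtain ⟨s, hs⟩ := Finset.card_pos.1 (lt_of_le_of_lt (Nat.zero_le _) hlt)
  rw [Finset.mem_filter] at hs
  have h2 := T.card_filter_subset (h.subset hs.1) hs.2
    (Finset.card_pair fun he => hab (h.injOn ha hb he))
  have := Finset.card_le_card (Finset.filter_subset_filter (({f a, f b} : Finset V) ⊆ ·) h.subset)
  omega

/-- If an edge lies in one triangle of `S` only, its other triangle can be added. -/
theorem exists_cons (h : Realizes T f k S) {a b : ℕ} (hab : a ≠ b) (hc : edgeCount S a b = 1) :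
    ∃ c ≤ k, c ≠ a ∧ c ≠ b ∧ c < Fintype.card V ∧ a < k ∧ b < k ∧
      ∃ g : ℕ → V, Realizes T g (if c = k then k + 1 else k) ((a, b, c) :: S) := by
  obtain ⟨t, ht, hte⟩ := List.countP_pos_iff.1 (show 0 < S.countP (Tri.hasEdge a b) by
    rw [show S.countP (Tri.hasEdge a b) = 1 from hc]; exact one_pos)
  have hte' := hte
  rw [Tri.hasEdge, Bool.and_eq_true] at hte
  have ha := Tri.below_of_hasVertex (h.below t ht) hte.1
  have hb := Tri.below_of_hasVertex (h.below t ht) hte.2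
  have hfab : f a ≠ f b := fun he => hab (h.injOn ha hb he)
  have h2 := T.card_filter_subset (h.mem_faces t ht)
    ((Tri.hasEdge_iff_subset h.injOn (h.below t ht) ha hb).1 hte') (Finset.card_pair hfab)
  have h1 := h.card_filter ha hb
  rw [hc] at h1
  -- `T` has two triangles at this edge and `S` only one of them; `s` is the other, and `w` below is
  -- its third vertex.
  obtain ⟨s, hs, hsS⟩ := Finset.exists_mem_notMem_of_card_lt_card (h1.trans_lt (by rw [h2]; simp))
  rw [Finset.mem_filter] at hs
  replace hsS : s ∉ (S.map (Tri.image f)).toFinset := fun hmem =>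
    hsS (Finset.mem_filter.2 ⟨hmem, hs.2⟩)
  obtain ⟨w, hw⟩ : ∃ w, s \ {f a, f b} = {w} := by
    rw [← Finset.card_eq_one, Finset.card_sdiff_of_subset hs.2, T.card_of_mem_faces s hs.1,
      Finset.card_pair hfab]
  have hsw : s = {f a, f b, w} := by
    rw [← Finset.sdiff_union_of_subset hs.2, hw]
    ext x
    simp only [Finset.mem_union, Finset.mem_singleton, Finset.mem_insert]
    tauto
  have hwab : w ≠ f a ∧ w ≠ f b := by
    have : w ∈ s \ {f a, f b} := by simp [hw]
    simpa using (Finset.mem_sdiff.1 this).2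
  by_cases hex : ∃ c < k, f c = w
  · obtain ⟨c, hck, rfl⟩ := hex
    refine ⟨c, hck.le, fun he => hwab.1 (he ▸ rfl), fun he => hwab.2 (he ▸ rfl),
      hck.trans_le h.le_card, ha, hb, f, ?_⟩
    rw [if_neg hck.ne]
    refine ⟨h.injOn, ?_, ?_, ?_⟩
    · exact List.forall_mem_cons.2 ⟨⟨ha, hb, hck⟩, h.below⟩
    · exact List.forall_mem_cons.2 ⟨by rw [Tri.image, ← hsw]; exact hs.1, h.mem_faces⟩
    · refine List.nodup_cons.2 ⟨fun hmem => hsS ?_, h.nodup⟩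
      rw [hsw]
      exact List.mem_toFinset.2 hmem
  · push Not at hex
    set g : ℕ → V := Function.update f k w with hg
    have hgf : ∀ x < k, g x = f x := fun x hx => Function.update_of_ne hx.ne _ _
    have hgk : g k = w := Function.update_self _ _ _
    have hinj : Set.InjOn g (Set.Iio (k + 1)) := by
      intro x hx y hy hxy
      rcases Nat.lt_succ_iff_lt_or_eq.1 hx with hx | rfl <;>
        rcases Nat.lt_succ_iff_lt_or_eq.1 hy with hy | rfl
      · rw [hgf x hx, hgf y hy] at hxy
        exact h.injOn hx hy hxy
      · rw [hgf x hx, hgk] at hxy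
        exact absurd hxy (hex x hx)
      · rw [hgf y hy, hgk] at hxy
        exact absurd hxy.symm (hex y hy)
      · rfl
    have hmap : S.map (Tri.image g) = S.map (Tri.image f) :=
      List.map_congr_left fun t ht => Tri.image_congr (h.below t ht) hgf
    have hR : Realizes T g (k + 1) ((a, b, k) :: S) := by
      have himg : Tri.image g (a, b, k) = s := by
        rw [hsw, Tri.image, hgf a ha, hgf b hb, hgk]
      refine ⟨hinj, ?_, ?_, ?_⟩
      · refine List.forall_mem_cons.2 ⟨⟨ha.trans k.lt_succ_self, hb.trans k.lt_succ_self,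
          k.lt_succ_self⟩, fun t ht => ?_⟩
        obtain ⟨h1, h2, h3⟩ := h.below t ht
        exact ⟨h1.trans k.lt_succ_self, h2.trans k.lt_succ_self, h3.trans k.lt_succ_self⟩
      · refine List.forall_mem_cons.2 ⟨himg ▸ hs.1, fun t ht => ?_⟩
        rw [Tri.image_congr (h.below t ht) hgf]
        exact h.mem_faces t ht
      · rw [List.map_cons, hmap]
        refine List.nodup_cons.2 ⟨fun hmem => hsS ?_, h.nodup⟩
        rw [← himg]
        exact List.mem_toFinset.2 hmem
    refine ⟨k, le_rfl, ha.ne', hb.ne', hR.le_card, ha, hb, g, ?_⟩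
    rwa [if_pos rfl]

end Realizes

theorem edgeCount_cons (t : Tri) (S : List Tri) (a b : ℕ) :
    edgeCount (t :: S) a b = edgeCount S a b + if t.hasEdge a b then 1 else 0 :=
  List.countP_cons

/-- The search visits, up to the numbering of the vertices, the list of all triangles of `T`. -/
theorem exists_leaf_of_searchTriangulations (T : SphereTriangulation V) {n : ℕ}
    (hn : Fintype.card V = n) (leaf : List Tri → Bool) (fuel : ℕ) :
    ∀ (k : ℕ) (S : List Tri) (Q : List (ℕ × ℕ)) (f : ℕ → V), Realizes T f k S → S ≠ [] →
      searchTriangulations n leaf fuel k S Q = true →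
      ∃ (S' : List Tri) (g : ℕ → V), Realizes T g n S' ∧ S' ≠ [] ∧ closedList S' = true ∧
        leaf S' = true := by
  have hF := T.card_faces
  induction fuel with
  | zero => intro k S Q f _ _ h; simp [searchTriangulations] at h
  | succ fuel ih =>
    rintro k S (_ | ⟨⟨a, b⟩, Q⟩) f hR hS h
    · rw [searchTriangulations, Bool.and_eq_true] at h
      obtain ⟨hc, h⟩ := h
      have hlen : S.length = T.faces.card := by rw [← hR.faces_eq hS hc, hR.card_toFinset]
      obtain ⟨e, -⟩ := hR.exists_equiv hS hc
      -- A closed list exhausts `T`, so the counts are right and the leaf test was really performed.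
      have hk : k = n := by rw [← hn, ← Fintype.card_congr e, Fintype.card_fin]
      subst hk
      have hlen' : Nat.beq (S.length + 4) (2 * k) = true := by
        rw [Nat.beq_eq]; omega
      rw [hlen', Nat.beq_refl] at h
      exact ⟨S, f, hR, hS, hc, by simpa using h⟩
    · rw [searchTriangulations] at h
      by_cases hcond : (Nat.beq (edgeCount S a b) 1 && !Nat.beq a b) = true
      · rw [hcond, cond_true, Bool.or_eq_true] at h
        rw [Bool.and_eq_true, Nat.beq_eq, Bool.not_eq_true', ← Bool.not_eq_true, Nat.beq_eq]
          at hcond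
        obtain ⟨c, hck, hca, hcb, hcn, ha, hb, g, hg⟩ := hR.exists_cons hcond.2 hcond.1
        have hlen := hg.length_le
        rw [List.length_cons] at hlen
        rcases h with h | h
        · have := Nat.le_of_ble_eq_true h
          omega
        · have h := List.all_eq_true.1 h c (List.mem_range.2 (Nat.lt_succ_of_le hck))
          have hlt : ∀ x ≤ k, (x = c ∨ x < k) → x < if c = k then k + 1 else k := by
            intro x hx hx'
            split_ifs <;> omega
          -- The enlarged list still has at most two triangles at `a c` and at `b c`, so before the
          -- enlargement there was at most one: these cuts do not apply to the true `c`.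
          have h1 := hg.edgeCount_le (hlt a ha.le (.inr ha)) (hlt c hck (.inl rfl)) hca.symm
          have h2 := hg.edgeCount_le (hlt b hb.le (.inr hb)) (hlt c hck (.inl rfl)) hcb.symm
          rw [edgeCount_cons, if_pos (by simp [Tri.hasEdge, Tri.hasVertex])] at h1 h2
          simp only [Bool.or_eq_true, Nat.beq_eq, Nat.ble_eq] at h
          have hs : searchTriangulations n leaf fuel (if c = k then k + 1 else k) ((a, b, c) :: S)
              (Q ++ [(a, c), (b, c)]) = true := by
            rcases h with h | h | h | h | h | h
            · omega
            · omega
            · omega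
            · omega
            · omega
            · by_cases hck' : c = k
              · simpa [hck'] using h
              · have : Nat.beq c k = false := by
                  rw [← Bool.not_eq_true, Nat.beq_eq]; exact hck'
                simpa [hck', this] using h
          exact ih _ _ _ g hg (List.cons_ne_nil _ _) hs
      · rw [Bool.not_eq_true] at hcond
        rw [hcond, cond_false] at h
        exact ih _ _ _ f hR hS h

/-- The initial state of the search. -/
theorem exists_realizes_singleton (T : SphereTriangulation V) :
    ∃ f : ℕ → V, Realizes T f 3 [(0, 1, 2)] := by
  obtain ⟨s, hs, -⟩ := T.exists_mem_face T.connected.nonempty.some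
  obtain ⟨x, y, z, hxy, hxz, hyz, rfl⟩ := Finset.card_eq_three.1 (T.card_of_mem_faces s hs)
  refine ⟨fun a => if a = 0 then x else if a = 1 then y else z, ?_, ?_, ?_, ?_⟩
  · intro a ha b hb
    simp only [Set.mem_Iio] at ha hb
    interval_cases a <;> interval_cases b <;> simp [hxy, hxz, hyz, hxy.symm, hxz.symm, hyz.symm]
  · simp [Tri.Below]
  · simpa [Tri.image] using hs
  · simp

theorem isEmbedding_of_searchEmbedding {n : ℕ} {G S : List Tri} {dG dS : List ℕ}
    {test : List ℕ → Bool} : ∀ (r k : ℕ) (p : List ℕ),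
      searchEmbedding n G S dG dS test r k p = true →
      ∃ p, isEmbedding n G S p = true ∧ test p = true := by
  intro r
  induction r with
  | zero =>
    intro k p h
    rw [searchEmbedding, Bool.and_eq_true] at h
    exact ⟨p, h⟩
  | succ r ih =>
    intro k p h
    rw [searchEmbedding] at h
    obtain ⟨v, -, h⟩ := List.any_eq_true.1 h
    simp only [Bool.and_eq_true] at h
    exact ih _ _ h.2.2.2

/-- An embedding in the list of triangles of a triangulation, in terms of the vertices of the
triangulation. -/
theorem Realizes.of_isEmbedding {T : SphereTriangulation V} {T' : SphereTriangulation W}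
    {f : ℕ → V} {g : ℕ → W} {n : ℕ} {G S : List Tri} {p : List ℕ} (hG : Realizes T' g n G)
    (hS : Realizes T f n S) (hp : isEmbedding n G S p = true) :
    Realizes T' (fun a => g (p.getD a 0)) n S := by
  simp only [isEmbedding, Bool.and_eq_true, decide_eq_true_eq, Nat.beq_eq, List.all_eq_true,
    List.any_eq_true] at hp
  obtain ⟨hnd, hlen, hlt, htri⟩ := hp
  have hgetD : ∀ a (ha : a < n), p.getD a 0 = p[a]'(by omega) := fun a ha =>
    List.getD_eq_getElem _ _ _
  have hinj : Set.InjOn (fun a => g (p.getD a 0)) (Set.Iio n) := by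
    intro a ha b hb hab
    simp only [Set.mem_Iio] at ha hb
    simp only [hgetD a ha, hgetD b hb] at hab
    have h1 := hlt _ (List.getElem_mem (l := p) (n := a) (by omega))
    have h2 := hlt _ (List.getElem_mem (l := p) (n := b) (by omega))
    have := hG.injOn (by simpa [Nat.blt] using h1) (by simpa [Nat.blt] using h2) hab
    exact (hnd.getElem_inj_iff).1 this
  refine ⟨hinj, hS.below, fun t ht => ?_, ?_⟩
  · obtain ⟨s, hs, hst⟩ := htri t ht
    have himg : Tri.image g (t.relabel p) = t.image fun a => g (p.getD a 0) := rfl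
    have h3 : (t.image fun a => g (p.getD a 0)).card = 3 := by
      rw [Tri.card_image hinj (hS.below t ht), ← Tri.card_image hS.injOn (hS.below t ht),
        T.card_of_mem_faces _ (hS.mem_faces t ht)]
    have hs' := hG.mem_faces s hs
    rw [← himg, Tri.image_eq_of_same hst (by rw [himg, h3, T'.card_of_mem_faces _ hs'])]
    exact hs'
  -- Both numberings are injective, so each identifies two triangles exactly when their sets of
  -- numbers agree.
  · refine (List.Nodup.of_map _ hS.nodup).map_on fun s hs t ht hst => ?_
    rw [Tri.image_eq_image_iff hinj (hS.below s hs) (hS.below t ht),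
      ← Tri.image_eq_image_iff hS.injOn (hS.below s hs) (hS.below t ht)] at hst
    exact List.inj_on_of_nodup_map hS.nodup hs ht hst

end Search

/-! ### The nine triangulations: completeness and distinctness. -/

section Classification

theorem SmallName.order_pos (i : SmallName) : 0 < i.order := by cases i <;> decide

/-- The numbering of the vertices of a named triangulation. -/
def SmallName.vertex (i : SmallName) (a : ℕ) : Fin i.order :=
  -- The remainder only makes the numbering total; it is the identity below the order.
  ⟨a % i.order, Nat.mod_lt _ i.order_pos⟩

theorem SmallName.vertex_val (i : SmallName) {a : ℕ} (ha : a < i.order) : (i.vertex a).val = a :=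
  Nat.mod_eq_of_lt ha

theorem SmallName.faces_eq (i : SmallName) :
    (small i).faces = (i.tris.map (Tri.image i.vertex)).toFinset := by
  cases i <;> rfl

theorem SmallName.realizes (i : SmallName) : Realizes (small i) i.vertex i.order i.tris := by
  refine ⟨fun a ha b hb hab => ?_, ?_, fun t ht => ?_, ?_⟩
  · rw [← i.vertex_val ha, ← i.vertex_val hb, hab]
  · cases i <;> decide
  · rw [i.faces_eq]
    exact List.mem_toFinset.2 (List.mem_map_of_mem ht)
  · cases i <;> decide +kernel

theorem SmallName.closedList_tris (i : SmallName) : closedList i.tris = true := by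
  cases i <;> decide

theorem SmallName.tris_ne_nil (i : SmallName) : i.tris ≠ [] := by
  cases i <;> exact List.cons_ne_nil _ _

/-- Fuel 30 is ample: three edges are queued at the start and two with each of at most nine further
triangles, which makes 21 queue steps and one final step. -/
theorem searchTriangulations_eq_true {n : ℕ} (h4 : 4 ≤ n) (h7 : n ≤ 7) :
    searchTriangulations n (isSmall n) 30 3 [(0, 1, 2)] [(0, 1), (0, 2), (1, 2)] = true := by
  interval_cases n <;> decide +kernel

variable {V W : Type*} [Fintype V] [DecidableEq V] [Fintype W] [DecidableEq W]

theorem exists_isIsomorphic_small (T : SphereTriangulation V) (h : Fintype.card V ≤ 7) :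
    ∃ i, T.IsIsomorphic (small i) := by
  obtain ⟨f, hf⟩ := T.exists_realizes_singleton
  obtain ⟨S, g, hR, hS, hc, hleaf⟩ := T.exists_leaf_of_searchTriangulations rfl _ _ _ _ _ f hf
    (List.cons_ne_nil _ _) (searchTriangulations_eq_true T.four_le_card h)
  obtain ⟨i, -, hi⟩ := List.any_eq_true.1 hleaf
  rw [Bool.and_eq_true, Nat.beq_eq] at hi
  obtain ⟨p, hp, -⟩ := isEmbedding_of_searchEmbedding _ _ _ hi.2
  rw [← hi.1] at hp hR
  obtain ⟨φ, -⟩ := hR.exists_iso (i.realizes.of_isEmbedding hR hp) hS hc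
  exact ⟨i, ⟨φ⟩⟩

/-- The number of vertices of degree `d`. -/
def degreeCount (T : SphereTriangulation V) (d : ℕ) : ℕ :=
  (Finset.univ.filter fun v => (T.faces.filter (v ∈ ·)).card = d).card

theorem Iso.card_filter_mem {T : SphereTriangulation V} {T' : SphereTriangulation W}
    (φ : T.Iso T') (v : V) :
    (T'.faces.filter (φ.toEquiv v ∈ ·)).card = (T.faces.filter (v ∈ ·)).card := by
  symm
  refine Finset.card_bij (fun s _ => s.map φ.toEquiv.toEmbedding) ?_ ?_ ?_
  · intro s hs
    rw [Finset.mem_filter] at hs ⊢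
    exact ⟨(φ.map_mem_faces s).2 hs.1, by simpa using hs.2⟩
  · intro s _ t _ hst
    exact Finset.map_injective _ hst
  · intro s hs
    rw [Finset.mem_filter] at hs
    have hmap : (s.map φ.toEquiv.symm.toEmbedding).map φ.toEquiv.toEmbedding = s := by
      simp [Finset.map_map]
    refine ⟨s.map φ.toEquiv.symm.toEmbedding, ?_, hmap⟩
    rw [Finset.mem_filter]
    exact ⟨by rw [← φ.map_mem_faces, hmap]; exact hs.1, by simpa using hs.2⟩

theorem Iso.degreeCount_eq {T : SphereTriangulation V} {T' : SphereTriangulation W}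
    (φ : T.Iso T') (d : ℕ) : T.degreeCount d = T'.degreeCount d := by
  refine Finset.card_equiv φ.toEquiv fun v => ?_
  simp only [Finset.mem_filter, Finset.mem_univ, true_and, φ.card_filter_mem]

theorem small_injective {i j : SmallName} (h : (small i).IsIsomorphic (small j)) : i = j := by
  obtain ⟨φ⟩ := h
  have hn := Fintype.card_congr φ.toEquiv
  have h4 := φ.degreeCount_eq 4
  have h5 := φ.degreeCount_eq 5
  cases i <;> cases j <;> first | rfl | (exfalso; revert hn h4 h5; decide +kernel)

end Classification

/-! ### Exhaustive search for edge colorings. -/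

section ColoringSearch

/-- The edges of the triangles in `G`, with vertices less than `n`. -/
def edgeList (n : ℕ) (G : List Tri) : List (ℕ × ℕ) :=
  ((List.range n).flatMap fun b => (List.range b).map fun a => (a, b)).filter
    fun e => G.any (Tri.hasEdge e.1 e.2)

/-- Some edge in the list `A` of coloured edges shares a triangle of `G` with the edge `a b` and has
the colour `k`. -/
def colorConflict (G : List Tri) (A : List (ℕ × ℕ × ℕ)) (a b k : ℕ) : Bool :=
  (G.filter (Tri.hasEdge a b)).any fun t => A.any fun s =>
    Nat.beq s.2.2 k && (t.hasEdge s.1 s.2.1 &&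
      -- Excluding the edge `a b` itself makes it unnecessary to prove that it is not yet in `A`.
      !((Nat.beq s.1 a || Nat.beq s.1 b) && (Nat.beq s.2.1 a || Nat.beq s.2.1 b)))

/-- Search for an extension of the partial colouring `A` to the given edges that does not pass the
test `leaf`. -/
def searchColorings (G : List Tri) (leaf : List (ℕ × ℕ × ℕ) → Bool) :
    List (ℕ × ℕ) → List (ℕ × ℕ × ℕ) → Bool
  | [], A => leaf A
  | (a, b) :: E, A => [0, 1, 2].all fun k =>
    colorConflict G A a b k || searchColorings G leaf E ((a, b, k) :: A)

/-- The colour of an edge whose endpoints have colours with sum `s`, the colours of the vertices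
being `1`, `2`, `4` and `8`. -/
def pairColor (s : ℕ) : Fin 3 :=
  -- The sums of two distinct colors are distinct: 3 and 12, 5 and 10, 6 and 9 are the three
  -- splittings of the four colors into pairs, i.e. the nonzero differences in the Klein four-group.
  bif Nat.beq s 3 || Nat.beq s 12 then 0 else bif Nat.beq s 5 || Nat.beq s 10 then 1 else 2

def colorRenamings : List (List ℕ) :=
  [[0, 1, 2], [0, 2, 1], [1, 0, 2], [1, 2, 0], [2, 0, 1], [2, 1, 0]]

/-- The colouring `A` is the one given by the list `v` of colours of the vertices, up to the
relabelling `p` of the vertices and a renaming of the colours. -/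
def isRenaming (A : List (ℕ × ℕ × ℕ)) (v p : List ℕ) : Bool :=
  colorRenamings.any fun s => A.all fun e =>
    Nat.beq (pairColor (v.getD (p.getD e.1 0) 0 + v.getD (p.getD e.2.1 0) 0)).val
      (s.getD e.2.2 0)

/-- Every colouring is equivalent to one of those given by colourings of the vertices in `R`. -/
def checkColorings (n : ℕ) (G : List Tri) (R : List (List ℕ)) : Bool :=
  searchColorings G (fun A => R.any fun v => searchEmbedding n G G (degreeList n G)
    (degreeList n G) (isRenaming A v) n 0 []) (edgeList n G) []

/-- Vertex colourings of the named triangulations with the colours `1`, `2`, `4` and `8`. -/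
def SmallName.vertexColorings : SmallName → List (List ℕ)
  | g4 => [[1, 2, 4, 8]]
  | g5 => [[1, 2, 4, 8, 4]]
  | g61 => [[1, 2, 4, 4, 2, 1], [1, 2, 4, 8, 2, 1]]
  | g62 => [[1, 2, 4, 8, 4, 8]]
  | g71 => [[1, 2, 4, 4, 2, 1, 8], [1, 2, 4, 8, 2, 1, 8]]
  | g72 => [[1, 2, 4, 2, 4, 8, 1]]
  | g73 => [[1, 2, 4, 8, 4, 8, 2]]
  | g74 => [[1, 2, 4, 8, 4, 8, 4]]
  | g75 => [[1, 2, 4, 8, 4, 8, 2]]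

theorem SmallName.checkColorings_eq_true (i : SmallName) :
    checkColorings i.order i.tris i.vertexColorings = true := by
  cases i <;> decide +kernel

end ColoringSearch

/-! ### Invariance and counting of colorings. -/

section Colorings

variable {V W : Type*} [Fintype V] [DecidableEq V] [Fintype W] [DecidableEq W]

namespace Iso

theorem mapEdge_symm_mapEdge {T : SphereTriangulation V} {T' : SphereTriangulation W}
    (φ : T.Iso T') (e : {e // e ∈ T'.edges}) : φ.mapEdge (φ.symm.mapEdge e) = e := by
  apply Subtype.ext
  simp [mapEdge, symm, Finset.map_map]

theorem symm_mapEdge_mapEdge {T : SphereTriangulation V} {T' : SphereTriangulation W}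
    (φ : T.Iso T') (e : {e // e ∈ T.edges}) : φ.symm.mapEdge (φ.mapEdge e) = e := by
  apply Subtype.ext
  simp [mapEdge, symm, Finset.map_map]

/-- The colouring pulled back along an isomorphism. -/
def pullback {T : SphereTriangulation V} {T' : SphereTriangulation W} (φ : T.Iso T')
    (c : T'.Coloring) : T.Coloring where
  color e := c.color (φ.mapEdge e)
  all_colors f hf k := by
    obtain ⟨e, hef, he⟩ := c.all_colors _ ((φ.map_mem_faces f).2 hf) k
    refine ⟨φ.symm.mapEdge e, ?_, by rw [φ.mapEdge_symm_mapEdge, he]⟩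
    rw [← φ.mapEdge_symm_mapEdge e] at hef
    exact Finset.map_subset_map.1 hef

/-- The automorphism of `T'` is conjugated by `φ`; the renaming of the colors stays the same. -/
theorem pullback_equivalent {T : SphereTriangulation V} {T' : SphereTriangulation W}
    (φ : T.Iso T') {c c' : T'.Coloring} (h : c.Equivalent c') :
    (φ.pullback c).Equivalent (φ.pullback c') := by
  obtain ⟨σ, ψ, h⟩ := h
  refine ⟨σ, (φ.trans ψ).trans φ.symm, fun e => ?_⟩
  have hmap : φ.mapEdge (((φ.trans ψ).trans φ.symm).mapEdge e) = ψ.mapEdge (φ.mapEdge e) :=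
    φ.mapEdge_symm_mapEdge (ψ.mapEdge (φ.mapEdge e)) ▸ by
      apply Subtype.ext
      simp [mapEdge, symm, trans, Finset.map_map, Equiv.trans_toEmbedding]
  change c'.color (φ.mapEdge _) = σ (c.color (φ.mapEdge e))
  rw [hmap, h]

theorem pullback_symm_pullback {T : SphereTriangulation V} {T' : SphereTriangulation W}
    (φ : T.Iso T') (c : T.Coloring) : φ.pullback (φ.symm.pullback c) = c := by
  obtain ⟨color, hc⟩ := c
  simp only [pullback, Coloring.mk.injEq]
  exact funext fun e => congrArg color (φ.symm_mapEdge_mapEdge e)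

theorem symm_pullback_pullback {T : SphereTriangulation V} {T' : SphereTriangulation W}
    (φ : T.Iso T') (c : T'.Coloring) : φ.symm.pullback (φ.pullback c) = c := by
  obtain ⟨color, hc⟩ := c
  simp only [pullback, Coloring.mk.injEq]
  exact funext fun e => congrArg color (φ.mapEdge_symm_mapEdge e)

theorem numColorings_eq {T : SphereTriangulation V} {T' : SphereTriangulation W}
    (φ : T.Iso T') : T.numColorings = T'.numColorings := by
  refine Nat.card_congr (Quotient.congr
    ⟨φ.symm.pullback, φ.pullback, φ.pullback_symm_pullback, φ.symm_pullback_pullback⟩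
    fun c c' => ⟨φ.symm.pullback_equivalent, fun h => ?_⟩)
  have := φ.pullback_equivalent h
  rw [Equiv.coe_fn_mk, pullback_symm_pullback, pullback_symm_pullback] at this
  exact this

end Iso

namespace Coloring

variable {T : SphereTriangulation V}

/-- The colour of an edge. -/
def colorOf (c : T.Coloring) (e : Finset V) : Fin 3 :=
  if h : e ∈ T.edges then c.color ⟨e, h⟩ else 0

theorem colorOf_eq (c : T.Coloring) (e : {e // e ∈ T.edges}) : c.colorOf e.1 = c.color e :=
  dif_pos e.2

/-- Three edges that attain three colors attain each of them only once. -/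
theorem colorOf_injOn (c : T.Coloring) {f : Finset V} (hf : f ∈ T.faces) :
    Set.InjOn c.colorOf (f.powersetCard 2) := by
  refine Finset.injOn_of_surjOn_of_card_le (t := Finset.univ) _ (fun _ _ => Finset.mem_coe.2
    (Finset.mem_univ _)) (fun k _ => ?_) ?_
  · obtain ⟨e, hef, he⟩ := c.all_colors f hf k
    obtain ⟨_, _, _, hc⟩ := T.mem_edges_iff.1 e.2
    exact ⟨e.1, Finset.mem_coe.2 (Finset.mem_powersetCard.2 ⟨hef, hc⟩), by rw [c.colorOf_eq, he]⟩
  · rw [Finset.card_powersetCard, T.card_of_mem_faces f hf]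
    simp [Nat.choose]

/-- The number of vertices `v` for which some colour does not occur at `v`. -/
def numMissing (c : T.Coloring) : ℕ :=
  (Finset.univ.filter fun v => ∃ k, ∀ e : {e // e ∈ T.edges}, v ∈ e.1 → c.color e ≠ k).card

/-- If `k` is missing at `v`, then `σ k` is missing at `φ v`, and conversely. This invariant
separates the two colorings of `G61` and those of `G71`. -/
theorem Equivalent.numMissing_eq {c c' : T.Coloring} (h : c.Equivalent c') :
    c.numMissing = c'.numMissing := by
  obtain ⟨σ, φ, h⟩ := h
  refine Finset.card_equiv φ.toEquiv fun v => ?_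
  simp only [Finset.mem_filter, Finset.mem_univ, true_and]
  constructor
  · rintro ⟨k, hk⟩
    refine ⟨σ k, fun e he => ?_⟩
    rw [← φ.mapEdge_symm_mapEdge e, h, σ.injective.ne_iff]
    refine hk _ ?_
    simpa [Iso.mapEdge, Iso.symm] using he
  · rintro ⟨k, hk⟩
    refine ⟨σ.symm k, fun e he hek => hk (φ.mapEdge e) ?_ ?_⟩
    · simpa [Iso.mapEdge] using he
    · rw [h, hek, Equiv.apply_symm_apply]

/-- The colouring of the edges given by a colouring of the vertices with the colours `1`, `2`, `4`
and `8`. -/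
def ofVertexColoring (T : SphereTriangulation V) (v : V → ℕ)
    (h : ∀ f ∈ T.faces, ∀ k, ∃ e ∈ f.powersetCard 2, pairColor (∑ u ∈ e, v u) = k) :
    T.Coloring where
  color e := pairColor (∑ u ∈ e.1, v u)
  all_colors f hf k := by
    obtain ⟨e, he, hk⟩ := h f hf k
    rw [Finset.mem_powersetCard] at he
    exact ⟨⟨e, T.mem_edges_iff.2 ⟨f, hf, he⟩⟩, he.1, hk⟩

end Coloring

theorem mem_edgeList {n : ℕ} {G : List Tri} {a b : ℕ} :
    (a, b) ∈ edgeList n G ↔ a < b ∧ b < n ∧ ∃ t ∈ G, t.hasEdge a b = true := by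
  simp only [edgeList, List.mem_filter, List.mem_flatMap, List.mem_range, List.mem_map,
    Prod.mk.injEq, List.any_eq_true]
  constructor
  · rintro ⟨⟨b', hb, a', ha, rfl, rfl⟩, h⟩
    exact ⟨ha, hb, h⟩
  · rintro ⟨ha, hb, h⟩
    exact ⟨⟨b, hb, a, ha, rfl, rfl⟩, h⟩

/-- The coloured edges in the list `A` have the colours given by `c`. -/
def Coloring.Extends {T : SphereTriangulation V} (c : T.Coloring) (f : ℕ → V) (n : ℕ)
    (G : List Tri) (A : List (ℕ × ℕ × ℕ)) : Prop :=
  ∀ s ∈ A, (s.1, s.2.1) ∈ edgeList n G ∧ s.2.2 = (c.colorOf {f s.1, f s.2.1}).val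

namespace Realizes

variable {T : SphereTriangulation V} {f : ℕ → V} {n : ℕ} {G : List Tri}

theorem exists_mem_edgeList (h : Realizes T f n G) (hG : G ≠ []) (hc : closedList G = true)
    {e : Finset V} (he : e ∈ T.edges) :
    ∃ a b, (a, b) ∈ edgeList n G ∧ e = {f a, f b} := by
  obtain ⟨s, hs, hes, hcard⟩ := T.mem_edges_iff.1 he
  rw [← h.faces_eq hG hc] at hs
  obtain ⟨t, ht, rfl⟩ := List.mem_map.1 (List.mem_toFinset.1 hs)
  obtain ⟨x, y, hxy, rfl⟩ := Finset.card_eq_two.1 hcard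
  obtain ⟨a, ha, rfl⟩ := h.surj hG hc x
  obtain ⟨b, hb, rfl⟩ := h.surj hG hc y
  rcases lt_trichotomy a b with hab | rfl | hab
  · exact ⟨a, b, mem_edgeList.2 ⟨hab, hb, t, ht,
      (Tri.hasEdge_iff_subset h.injOn (h.below t ht) ha hb).2 hes⟩, rfl⟩
  · exact absurd rfl hxy
  · rw [Finset.pair_comm] at hes ⊢
    exact ⟨b, a, mem_edgeList.2 ⟨hab, ha, t, ht,
      (Tri.hasEdge_iff_subset h.injOn (h.below t ht) hb ha).2 hes⟩, rfl⟩

theorem colorConflict_eq_false (h : Realizes T f n G) (c : T.Coloring) {A : List (ℕ × ℕ × ℕ)}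
    (hA : c.Extends f n G A) {a b : ℕ} (hab : (a, b) ∈ edgeList n G) :
    colorConflict G A a b (c.colorOf {f a, f b}).val = false := by
  rw [← Bool.not_eq_true]
  intro hcon
  obtain ⟨t, ht, hcon⟩ := List.any_eq_true.1 hcon
  obtain ⟨⟨x, y, k⟩, hs, hcon⟩ := List.any_eq_true.1 hcon
  rw [List.mem_filter] at ht
  obtain ⟨hxy, hkxy⟩ := hA _ hs
  dsimp only at hxy hkxy hcon
  rw [mem_edgeList] at hab hxy
  have hb := hab.2.1
  have ha := hab.1.trans hb
  have hy := hxy.2.1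
  have hx := hxy.1.trans hy
  simp only [Bool.and_eq_true, Nat.beq_eq, Bool.not_eq_true'] at hcon
  obtain ⟨hk, hte, hne⟩ := hcon
  have heq := c.colorOf_injOn (h.mem_faces t ht.1)
    (Finset.mem_coe.2 (Finset.mem_powersetCard.2
      ⟨(Tri.hasEdge_iff_subset h.injOn (h.below t ht.1) hx hy).1 hte,
        Finset.card_pair fun he => hxy.1.ne (h.injOn hx hy he)⟩))
    (Finset.mem_coe.2 (Finset.mem_powersetCard.2
      ⟨(Tri.hasEdge_iff_subset h.injOn (h.below t ht.1) ha hb).1 ht.2,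
        Finset.card_pair fun he => hab.1.ne (h.injOn ha hb he)⟩)) (Fin.ext (hkxy.symm.trans hk))
  rw [← Bool.not_eq_true] at hne
  refine hne ?_
  -- Two edges of one triangle with the same color coincide, so the supposed conflict is the edge `a
  -- b` with itself.
  have hmem : ∀ z < n, f z ∈ ({f x, f y} : Finset V) → z = a ∨ z = b := by
    intro z hz hmem
    rw [heq, Finset.mem_insert, Finset.mem_singleton] at hmem
    exact hmem.imp (h.injOn hz ha) (h.injOn hz hb)
  simp only [Bool.and_eq_true, Bool.or_eq_true, Nat.beq_eq]
  exact ⟨hmem x hx (by simp), hmem y hy (by simp)⟩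

theorem exists_leaf_of_searchColorings (h : Realizes T f n G) (c : T.Coloring)
    (leaf : List (ℕ × ℕ × ℕ) → Bool) (E : List (ℕ × ℕ)) :
    ∀ A, c.Extends f n G A → (∀ e ∈ E, e ∈ edgeList n G) →
      (∀ e ∈ edgeList n G, e ∈ E ∨ ∃ k, (e.1, e.2, k) ∈ A) → searchColorings G leaf E A = true →
      ∃ A', c.Extends f n G A' ∧ (∀ e ∈ edgeList n G, ∃ k, (e.1, e.2, k) ∈ A') ∧
        leaf A' = true := by
  induction E with
  | nil =>
    intro A hA _ hcov hs
    exact ⟨A, hA, fun e he => (hcov e he).resolve_left (by simp), hs⟩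
  | cons e E ih =>
    obtain ⟨a, b⟩ := e
    intro A hA hE hcov hs
    rw [List.forall_mem_cons] at hE
    have hk : (c.colorOf {f a, f b}).val ∈ [0, 1, 2] := by
      have := (c.colorOf {f a, f b}).isLt
      simp only [List.mem_cons, List.not_mem_nil, or_false]
      omega
    rw [searchColorings] at hs
    have hs' := List.all_eq_true.1 hs _ hk
    rw [h.colorConflict_eq_false c hA hE.1, Bool.false_or] at hs'
    refine ih _ (List.forall_mem_cons.2 ⟨⟨hE.1, rfl⟩, hA⟩) hE.2 (fun e he => ?_) hs'
    rcases hcov e he with he | ⟨k, hk⟩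
    · rcases List.mem_cons.1 he with rfl | he
      · exact .inr ⟨_, List.mem_cons_self⟩
      · exact .inl he
    · exact .inr ⟨k, List.mem_cons_of_mem _ hk⟩

end Realizes

theorem exists_perm_of_mem_colorRenamings : ∀ s ∈ colorRenamings, ∃ σ : Equiv.Perm (Fin 3),
    ∀ k : Fin 3, s.getD k.val 0 = (σ k).val := by
  decide +kernel

/-- The search branch that follows `c` ends in a full list of its colors, for which an automorphism
and a renaming were found. Quantifying over `r` postpones the check that the vertex coloring `v`
does give a coloring. -/
theorem SmallName.exists_equivalent (i : SmallName) (c : (small i).Coloring) :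
    ∃ v ∈ i.vertexColorings, ∀ r : (small i).Coloring,
      (∀ e, r.color e = pairColor (∑ u ∈ e.1, v.getD u.val 0)) → c.Equivalent r := by
  have hR := i.realizes
  obtain ⟨A, hA, hcov, hleaf⟩ := hR.exists_leaf_of_searchColorings c _ _ []
    (by simp [Coloring.Extends]) (fun _ => id) (fun e he => .inl he) i.checkColorings_eq_true
  obtain ⟨v, hv, hleaf⟩ := List.any_eq_true.1 hleaf
  obtain ⟨p, hp, hren⟩ := isEmbedding_of_searchEmbedding _ _ _ hleaf
  have hR' := hR.of_isEmbedding hR hp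
  obtain ⟨φ, hφ⟩ := hR.exists_iso hR' i.tris_ne_nil i.closedList_tris
  obtain ⟨s, hs, hren⟩ := List.any_eq_true.1 hren
  obtain ⟨σ, hσ⟩ := exists_perm_of_mem_colorRenamings s hs
  have hlt : ∀ a < i.order, p.getD a 0 < i.order := by
    intro a ha
    simp only [isEmbedding, Bool.and_eq_true, Nat.beq_eq, List.all_eq_true] at hp
    rw [List.getD_eq_getElem _ _ (hp.2.1.symm ▸ ha)]
    simpa [Nat.blt] using hp.2.2.1 _ (List.getElem_mem _)
  refine ⟨v, hv, fun r hr => ⟨σ, φ, fun e => ?_⟩⟩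
  obtain ⟨a, b, hab, he⟩ := hR.exists_mem_edgeList i.tris_ne_nil i.closedList_tris e.2
  obtain ⟨k, hk⟩ := hcov _ hab
  have hcol := (hA _ hk).2
  rw [← he, c.colorOf_eq] at hcol
  have hren := List.all_eq_true.1 hren _ hk
  rw [Nat.beq_eq, hcol, hσ] at hren
  rw [mem_edgeList] at hab
  have hb := hab.2.1
  have ha := hab.1.trans hb
  rw [← Fin.ext hren, hr]
  have hmap : (φ.mapEdge e).1 = {i.vertex (p.getD a 0), i.vertex (p.getD b 0)} := by
    simp only [Iso.mapEdge, he, Finset.map_insert, Finset.map_singleton, Equiv.coe_toEmbedding,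
      hφ a ha, hφ b hb]
  rw [hmap, Finset.sum_pair fun hpab => hab.1.ne (hR'.injOn ha hb hpab),
    i.vertex_val (hlt a ha), i.vertex_val (hlt b hb)]

theorem numColorings_eq_one {T : SphereTriangulation V} (r : T.Coloring)
    (h : ∀ c : T.Coloring, c.Equivalent r) : T.numColorings = 1 := by
  rw [numColorings, Nat.card_eq_one_iff_exists]
  refine ⟨Quotient.mk _ r, fun q => ?_⟩
  induction q using Quotient.inductionOn with
  | h c => exact Quotient.sound (h c)

theorem numColorings_eq_two {T : SphereTriangulation V} (r r' : T.Coloring)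
    (hr : ¬ r.Equivalent r') (h : ∀ c : T.Coloring, c.Equivalent r ∨ c.Equivalent r') :
    T.numColorings = 2 := by
  rw [numColorings, Nat.card_eq_two_iff]
  refine ⟨Quotient.mk _ r, Quotient.mk _ r', fun he => hr (Quotient.exact he), ?_⟩
  refine Set.eq_univ_of_forall fun q => ?_
  induction q using Quotient.inductionOn with
  | h c => exact (h c).imp (fun h => Quotient.sound h) (fun h => Quotient.sound h)

/-- The colouring of a named triangulation that is given by the list `v` of colours of the
vertices. -/
def SmallName.coloring (i : SmallName) (v : List ℕ)
    (h : ∀ f ∈ (small i).faces, ∀ k, ∃ e ∈ f.powersetCard 2,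
      pairColor (∑ u ∈ e, v.getD u.val 0) = k) : (small i).Coloring :=
  Coloring.ofVertexColoring (small i) (fun u => v.getD u.val 0) h

theorem SmallName.numColorings_eq_one (i : SmallName) {v : List ℕ} (hv : i.vertexColorings = [v])
    (h : ∀ f ∈ (small i).faces, ∀ k, ∃ e ∈ f.powersetCard 2,
      pairColor (∑ u ∈ e, v.getD u.val 0) = k) : (small i).numColorings = 1 := by
  refine SphereTriangulation.numColorings_eq_one (i.coloring v h) fun c => ?_
  obtain ⟨w, hw, hc⟩ := i.exists_equivalent c
  rw [hv, List.mem_singleton] at hw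
  subst hw
  exact hc _ fun _ => rfl

theorem SmallName.numColorings_eq_two (i : SmallName) {v w : List ℕ}
    (hvw : i.vertexColorings = [v, w])
    (hv : ∀ f ∈ (small i).faces, ∀ k, ∃ e ∈ f.powersetCard 2,
      pairColor (∑ u ∈ e, v.getD u.val 0) = k)
    (hw : ∀ f ∈ (small i).faces, ∀ k, ∃ e ∈ f.powersetCard 2,
      pairColor (∑ u ∈ e, w.getD u.val 0) = k)
    (hne : (i.coloring v hv).numMissing ≠ (i.coloring w hw).numMissing) :
    (small i).numColorings = 2 := by
  refine SphereTriangulation.numColorings_eq_two (i.coloring v hv) (i.coloring w hw)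
    (fun he => hne he.numMissing_eq) fun c => ?_
  obtain ⟨x, hx, hc⟩ := i.exists_equivalent c
  rw [hvw, List.mem_cons, List.mem_singleton] at hx
  rcases hx with rfl | rfl
  · exact .inl (hc _ fun _ => rfl)
  · exact .inr (hc _ fun _ => rfl)

theorem numColorings_small (i : SmallName) :
    (small i).numColorings = i.vertexColorings.length := by
  cases i
  case g61 =>
    exact SmallName.numColorings_eq_two .g61 rfl (by decide +kernel) (by decide +kernel)
      (by decide +kernel)
  case g71 =>
    exact SmallName.numColorings_eq_two .g71 rfl (by decide +kernel) (by decide +kernel)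
      (by decide +kernel)
  all_goals exact SmallName.numColorings_eq_one _ rfl (by decide +kernel)

end Colorings

end SphereTriangulation

open SphereTriangulation in
theorem mainTheorem1 :
    -- The octahedron `G61` and the triangulation `G71` have two colorings; the others have one.
    (G61.numColorings = 2 ∧ G71.numColorings = 2 ∧
      G4.numColorings = 1 ∧ G5.numColorings = 1 ∧ G62.numColorings = 1 ∧ G72.numColorings = 1 ∧
      G73.numColorings = 1 ∧ G74.numColorings = 1 ∧ G75.numColorings = 1) ∧
    -- Every triangulation with at most 7 vertices is one of the nine, and it has exactly two
    -- colorings if it is `G61` or `G71`, and exactly one coloring otherwise.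
    ∀ {V : Type*} [Fintype V] [DecidableEq V] (T : SphereTriangulation V), Fintype.card V ≤ 7 →
      (∃! i : SmallName, T.IsIsomorphic (small i)) ∧
      (((T.IsIsomorphic G61 ∨ T.IsIsomorphic G71) ∧ T.numColorings = 2) ∨
        (¬ T.IsIsomorphic G61 ∧ ¬ T.IsIsomorphic G71 ∧ T.numColorings = 1)) := by
  refine ⟨⟨numColorings_small .g61, numColorings_small .g71, numColorings_small .g4,
    numColorings_small .g5, numColorings_small .g62, numColorings_small .g72,
    numColorings_small .g73, numColorings_small .g74, numColorings_small .g75⟩, ?_⟩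
  intro V _ _ T hT
  obtain ⟨i, ⟨φ⟩⟩ := T.exists_isIsomorphic_small hT
  have huniq : ∀ j, T.IsIsomorphic (small j) → j = i := fun j ⟨ψ⟩ =>
    small_injective ⟨ψ.symm.trans φ⟩
  refine ⟨⟨i, ⟨φ⟩, huniq⟩, ?_⟩
  have hnum := φ.numColorings_eq.trans (numColorings_small i)
  by_cases h61 : i = .g61
  · subst h61
    exact .inl ⟨.inl ⟨φ⟩, hnum⟩
  by_cases h71 : i = .g71
  · subst h71
    exact .inl ⟨.inr ⟨φ⟩, hnum⟩
  refine .inr ⟨fun h => h61 (huniq .g61 h).symm, fun h => h71 (huniq .g71 h).symm, ?_⟩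
  rw [hnum]
  cases i <;> first | rfl | contradiction
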